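/- A *(Čech) closure space* $(X,c)$ is a set $X$ with a map $c:2^X\to 2^X$ satisfying $c(\varnothing)=\varnothing$, $A\subset c(A)$ and $c(A\cup B)=c(A)\cup c(B)$ for all $A,B\subset X$; a map $f:(X,c)\to(Y,d)$ is *continuous* if $f(c(A))\subset d(f(A))$ for all $A\subset X$. A set $V\subset X$ is a *neighborhood* of $x$ if $x\notin c(X\setminus V)$, and in the product $X\times Y$ of two closure spaces a point $(x,y)$ lies in the closure of $B$ if $(V\times W)\cap B\neq\varnothing$ for all neighborhoods $V$ of $x$ and $W$ of $y$. Topological spaces are regarded as closure spaces through their closure operators, and $I=[0,1]$ carries its standard topology. The space $X$ is *path-connected* if for all $x,y\in X$ there is a continuous $\alpha:I\to X$ with $\alpha(0)=x$ and $\alpha(1)=y$. For $x_0\in X$ let $\pi_1(X,x_0)$ be the group of homotopy classes $[f]$ of loops, that is, of continuous $f:I\to X$ with $f(0)=f(1)=x_0$; a homotopy from $f$ to $g$ is a continuous $H:I\times I\to X$ with $H(t,0)=f(t)$, $H(t,1)=g(t)$ and $H(0,s)=H(1,s)=x_0$, and the product is concatenation of loops. Let $C_n(X)$ be the free abelian group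 on the continuous maps $\sigma:|\Delta^n|\to X$, where $|\Delta^n|=[e_0,\dots,e_n]\subset\mathbb{R}^{n+1}$ is the standard simplex with the Euclidean topology; let $\partial_n:C_n(X)\to C_{n-1}(X)$ be given by $\partial_n\sigma=\sum_{i=0}^n(-1)^i\,\sigma|_{[e_0,\dots,\widehat{e_i},\dots,e_n]}$ for $n\ge 1$ and $\partial_0=0$; and let $H_n(X)=\ker\partial_n/\operatorname{im}\partial_{n+1}$. The *Hurewicz map* $h:\pi_1(X,x_0)\to H_1(X)$ is the group homomorphism that sends $[f]$ to the homology class of $f$, viewed as a singular $1$-simplex through the affine homeomorphism $|\Delta^1|\cong I$ with $e_0\mapsto 0$, $e_1\mapsto 1$. **Theorem (Hurewicz theorem).** Let $X$ be a path-connected closure space and let $x_0\in X$. Then $h:\pi_1(X,x_0)\to H_1(X)$ is surjective and its kernel is the commutator subgroup of $\pi_1(X,x_0)$. Hence $h$ induces an isomorphism from the abelianization of $\pi_1(X,x_0)$ onto $H_1(X)$. -/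

import Mathlib

open Set Filter Topology

universe u v w

/-- A Čech closure operator on a set `X`. Idempotency is not required. -/
structure CechClosure (X : Type u) where
  cl : Set X → Set X
  cl_empty : cl ∅ = ∅
  subset_cl : ∀ A, A ⊆ cl A
  cl_union : ∀ A B, cl (A ∪ B) = cl A ∪ cl B

namespace CechClosure

variable {X : Type u} {Y : Type v} {Z : Type w}

/-! ### Closure spaces and continuous maps -/

theorem cl_mono (c : CechClosure X) {A B : Set X} (h : A ⊆ B) : c.cl A ⊆ c.cl B := by
  rw [← union_eq_self_of_subset_left h, c.cl_union]
  exact subset_union_left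

/-- The interior operation of a closure space. -/
def interior (c : CechClosure X) (A : Set X) : Set X := (c.cl Aᶜ)ᶜ

/-- The filter of neighborhoods of a point: `V` is a neighborhood of `x` when `x` lies in the
interior of `V`. -/
def nhds (c : CechClosure X) (x : X) : Filter X where
  sets := {V | x ∈ c.interior V}
  univ_sets := by simp [interior, c.cl_empty]
  sets_of_superset := fun {A B} hA hAB hB => hA (c.cl_mono (compl_subset_compl.2 hAB) hB)
  inter_sets := fun {A B} hA hB => by
    simp only [interior, mem_ofPred_eq, mem_compl_iff] at *
    rw [compl_inter, c.cl_union]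
    exact fun h => h.elim hA hB

theorem mem_nhds (c : CechClosure X) {x : X} {V : Set X} :
    V ∈ c.nhds x ↔ x ∈ c.interior V := Iff.rfl

/-- A map of closure spaces is continuous if `f (c A) ⊆ d (f A)` for every subset `A`. -/
def IsContinuous (c : CechClosure X) (d : CechClosure Y) (f : X → Y) : Prop :=
  ∀ A : Set X, f '' c.cl A ⊆ d.cl (f '' A)

theorem isContinuous_iff {c : CechClosure X} {d : CechClosure Y} {f : X → Y} :
    IsContinuous c d f ↔ ∀ x, Tendsto f (c.nhds x) (d.nhds (f x)) := by
  constructor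
  · intro hf x V hV hx
    exact hV (d.cl_mono (by rintro _ ⟨y, hy, rfl⟩; exact hy) (hf _ ⟨x, hx, rfl⟩))
  · rintro hf A _ ⟨x, hx, rfl⟩
    by_contra h
    have hV : (f '' A)ᶜ ∈ d.nhds (f x) := by
      simpa [mem_nhds, interior] using h
    have hA : A ⊆ (f ⁻¹' (f '' A)ᶜ)ᶜ := by
      intro a ha hn
      exact hn ⟨a, ha, rfl⟩
    exact hf x hV (c.cl_mono hA hx)

theorem IsContinuous.comp {c : CechClosure X} {d : CechClosure Y} {e : CechClosure Z}
    {g : Y → Z} {f : X → Y} (hg : IsContinuous d e g) (hf : IsContinuous c d f) :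
    IsContinuous c e (g ∘ f) := fun A => by
  rw [image_comp, image_comp]
  exact (image_mono (hf A)).trans (hg _)

/-- The closure operator of a topological space. -/
def ofTopology (T : Type v) [TopologicalSpace T] : CechClosure T where
  cl := closure
  cl_empty := closure_empty
  subset_cl := fun _ => subset_closure
  cl_union := fun _ _ => closure_union

theorem nhds_ofTopology (T : Type v) [TopologicalSpace T] (t : T) :
    (ofTopology T).nhds t = 𝓝 t := by
  ext V
  rw [mem_nhds, ← mem_interior_iff_mem_nhds]
  simp [CechClosure.interior, ofTopology]

theorem isContinuous_of_continuous {T : Type v} {S : Type w} [TopologicalSpace T]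
    [TopologicalSpace S] {f : T → S} (hf : Continuous f) :
    IsContinuous (ofTopology T) (ofTopology S) f :=
  fun _ => image_closure_subset_closure_image hf

theorem isContinuous_const (c : CechClosure X) (d : CechClosure Y) (y : Y) :
    IsContinuous c d (fun _ => y) := by
  rw [isContinuous_iff]
  intro x V hV
  have hy : y ∈ V := by
    by_contra h
    exact hV (d.subset_cl _ h)
  exact mem_map.2 (mem_of_superset univ_mem fun _ _ => hy)

/-- The product closure operator: `p` lies in the closure of `B` if every product of a
neighborhood of `p.1` and a neighborhood of `p.2` meets `B`. -/
def prod (c : CechClosure X) (d : CechClosure Y) : CechClosure (X × Y) where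
  cl B := {p | ∀ V ∈ c.nhds p.1, ∀ W ∈ d.nhds p.2, ((V ×ˢ W) ∩ B).Nonempty}
  cl_empty := by
    ext p
    simp only [mem_ofPred_eq, inter_empty, mem_empty_iff_false, iff_false]
    intro h
    exact not_nonempty_empty (h univ univ_mem univ univ_mem)
  subset_cl := fun B p hp V hV W hW => by
    refine ⟨p, ⟨?_, ?_⟩, hp⟩
    · by_contra h
      exact hV (c.subset_cl _ h)
    · by_contra h
      exact hW (d.subset_cl _ h)
  cl_union := fun A B => by
    apply Subset.antisymm
    · intro p hp
      by_contra h
      simp only [mem_union, mem_ofPred_eq, not_or, not_forall] at h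
      obtain ⟨⟨V, hV, W, hW, hA⟩, ⟨V₂, hV₂, W₂, hW₂, hB⟩⟩ := h
      obtain ⟨q, ⟨hq1, hq2⟩, hq⟩ := hp (V ∩ V₂) (inter_mem hV hV₂) (W ∩ W₂) (inter_mem hW hW₂)
      rcases hq with hq | hq
      · exact hA ⟨q, ⟨hq1.1, hq2.1⟩, hq⟩
      · exact hB ⟨q, ⟨hq1.2, hq2.2⟩, hq⟩
    · rintro p (hp | hp) V hV W hW
      · exact (hp V hV W hW).mono (inter_subset_inter_right _ subset_union_left)
      · exact (hp V hV W hW).mono (inter_subset_inter_right _ subset_union_right)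

theorem prod_ofTopology (T : Type v) (S : Type w) [TopologicalSpace T] [TopologicalSpace S] :
    (ofTopology T).prod (ofTopology S) = ofTopology (T × S) := by
  have h : ∀ B : Set (T × S),
      ((ofTopology T).prod (ofTopology S)).cl B = (ofTopology (T × S)).cl B := by
    intro B
    ext p
    change (∀ V ∈ (ofTopology T).nhds p.1, ∀ W ∈ (ofTopology S).nhds p.2,
      ((V ×ˢ W) ∩ B).Nonempty) ↔ p ∈ closure B
    rw [nhds_ofTopology, nhds_ofTopology, mem_closure_iff_nhds]
    constructor
    · intro h U hU
      obtain ⟨V, hV, W, hW, hVW⟩ := mem_nhds_prod_iff.1 hU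
      exact (h V hV W hW).mono (inter_subset_inter_left _ hVW)
    · intro h V hV W hW
      exact h _ (prod_mem_nhds hV hW)
  have h2 := funext h
  cases hc : (ofTopology T).prod (ofTopology S)
  cases hd : ofTopology (T × S)
  simp only [hc, hd] at h2
  subst h2
  rfl

/-- Pasting two maps out of a topological space along a level set of a continuous function. -/
theorem IsContinuous.paste {T : Type v} [TopologicalSpace T] {c : CechClosure X}
    {k : T → ℝ} (hk : Continuous k) (a : ℝ) {F G : T → X}
    (hF : IsContinuous (ofTopology T) c F) (hG : IsContinuous (ofTopology T) c G)
    (hFG : ∀ t, k t = a → F t = G t) :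
    IsContinuous (ofTopology T) c (fun t => if k t ≤ a then F t else G t) := by
  rw [isContinuous_iff] at *
  intro t V hV
  have hF := hF t
  have hG := hG t
  rw [nhds_ofTopology] at *
  rw [mem_map]
  rcases lt_trichotomy (k t) a with h | h | h
  · rw [if_pos h.le] at hV
    filter_upwards [hF hV, hk.continuousAt.eventually (gt_mem_nhds h)] with s hs hs2
    simpa [hs2.le] using hs
  · rw [if_pos h.le] at hV
    have hV2 : V ∈ c.nhds (G t) := hFG t h ▸ hV
    filter_upwards [hF hV, hG hV2] with s hs hs2
    change (if k s ≤ a then F s else G s) ∈ V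
    split_ifs
    exacts [hs, hs2]
  · rw [if_neg h.not_ge] at hV
    filter_upwards [hG hV, hk.continuousAt.eventually (lt_mem_nhds h)] with s hs hs2
    simpa [hs2.not_ge] using hs

/-! ### Paths and the fundamental group -/

/-- The unit interval with its standard topology, as a closure space. -/
abbrev unitI : CechClosure unitInterval := ofTopology unitInterval

/-- A path from `x` to `y` in the closure space `(X, c)`. -/
@[ext] structure CPath (c : CechClosure X) (x y : X) where
  toFun : unitInterval → X
  continuous_toFun : IsContinuous unitI c toFun
  source : toFun 0 = x
  target : toFun 1 = y

/-- Every two points are joined by a path. -/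
def IsPathConnected (c : CechClosure X) : Prop := ∀ x y : X, Nonempty (CPath c x y)

namespace CPath

variable {c : CechClosure X} {x y z : X}

/-- Homotopy of paths with fixed endpoints. For loops at `x` this is homotopy of maps of pairs
from the interval and its boundary to `(X, x)`. -/
def Homotopic (f g : CPath c x y) : Prop :=
  ∃ H : unitInterval × unitInterval → X, IsContinuous (unitI.prod unitI) c H ∧
    (∀ t, H (t, 0) = f.toFun t) ∧ (∀ t, H (t, 1) = g.toFun t) ∧
    (∀ s, H (0, s) = x) ∧ (∀ s, H (1, s) = y)

theorem homotopic_iff {f g : CPath c x y} : Homotopic f g ↔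
    ∃ H : unitInterval × unitInterval → X,
      IsContinuous (ofTopology (unitInterval × unitInterval)) c H ∧
      (∀ t, H (t, 0) = f.toFun t) ∧ (∀ t, H (t, 1) = g.toFun t) ∧
      (∀ s, H (0, s) = x) ∧ (∀ s, H (1, s) = y) := by
  rw [← prod_ofTopology]
  exact Iff.rfl

/-- Two paths that are reparametrizations of a common map are homotopic. -/
theorem homotopic_of_reparam (k : unitInterval → X) (hk : IsContinuous unitI c k)
    (φ ψ : unitInterval → unitInterval) (hφ : Continuous φ) (hψ : Continuous ψ)
    (h0 : φ 0 = ψ 0) (h1 : φ 1 = ψ 1) (f g : CPath c x y)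
    (hf : ∀ t, f.toFun t = k (φ t)) (hg : ∀ t, g.toFun t = k (ψ t)) : Homotopic f g := by
  let m : unitInterval × unitInterval → unitInterval := fun p =>
    projIcc 0 1 zero_le_one ((1 - (p.2 : ℝ)) * φ p.1 + p.2 * ψ p.1)
  have hm : Continuous m := by
    apply continuous_projIcc.comp
    fun_prop
  refine homotopic_iff.2 ⟨k ∘ m, hk.comp (isContinuous_of_continuous hm), ?_, ?_, ?_, ?_⟩
  · intro t
    simp [m, hf]
  · intro t
    simp [m, hg]
  · intro s
    have : m (0, s) = φ 0 := by
      simp only [m, ← h0]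
      rw [show (1 - (s : ℝ)) * (φ 0 : ℝ) + s * (φ 0 : ℝ) = φ 0 by ring]
      simp
    simp only [Function.comp_apply, this, ← hf, f.source]
  · intro s
    have : m (1, s) = φ 1 := by
      simp only [m, ← h1]
      rw [show (1 - (s : ℝ)) * (φ 1 : ℝ) + s * (φ 1 : ℝ) = φ 1 by ring]
      simp
    simp only [Function.comp_apply, this, ← hf, f.target]

theorem Homotopic.refl (f : CPath c x y) : Homotopic f f :=
  homotopic_of_reparam f.toFun f.continuous_toFun id id continuous_id continuous_id rfl rfl f f
    (fun _ => rfl) (fun _ => rfl)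

theorem Homotopic.symm {f g : CPath c x y} (h : Homotopic f g) : Homotopic g f := by
  obtain ⟨H, hH, h0, h1, hx, hy⟩ := homotopic_iff.1 h
  refine homotopic_iff.2 ⟨H ∘ fun p => (p.1, unitInterval.symm p.2),
    hH.comp (isContinuous_of_continuous (by fun_prop)), ?_, ?_, ?_, ?_⟩ <;> intro t <;>
    simp [h0, h1, hx, hy]

/-- The clamped map `t ↦ 2 t`, with value `1` for `t ≥ 1 / 2`. -/
noncomputable def firstHalf (t : unitInterval) : unitInterval := projIcc 0 1 zero_le_one (2 * (t : ℝ))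

/-- The clamped map `t ↦ 2 t - 1`, with value `0` for `t ≤ 1 / 2`. -/
noncomputable def secondHalf (t : unitInterval) : unitInterval := projIcc 0 1 zero_le_one (2 * (t : ℝ) - 1)

theorem continuous_firstHalf : Continuous firstHalf :=
  continuous_projIcc.comp (by fun_prop)

theorem continuous_secondHalf : Continuous secondHalf :=
  continuous_projIcc.comp (by fun_prop)

theorem firstHalf_of_eq {t : unitInterval} (h : (t : ℝ) = 1 / 2) : firstHalf t = 1 := by
  simp [firstHalf, h]

theorem secondHalf_of_le {t : unitInterval} (h : (t : ℝ) ≤ 1 / 2) : secondHalf t = 0 :=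
  projIcc_of_le_left _ (by linarith)

@[simp] theorem firstHalf_zero : firstHalf 0 = 0 := by simp [firstHalf]

@[simp] theorem secondHalf_one : secondHalf 1 = 1 := by norm_num [secondHalf]

theorem coe_firstHalf {t : unitInterval} (h : (t : ℝ) ≤ 1 / 2) : (firstHalf t : ℝ) = 2 * t := by
  have := t.2.1
  rw [firstHalf, projIcc_of_mem _ ⟨by linarith, by linarith⟩]

theorem coe_secondHalf {t : unitInterval} (h : 1 / 2 ≤ (t : ℝ)) :
    (secondHalf t : ℝ) = 2 * t - 1 := by
  have := t.2.2
  rw [secondHalf, projIcc_of_mem _ ⟨by linarith, by linarith⟩]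

theorem Homotopic.trans {f g h : CPath c x y} (h₁ : Homotopic f g) (h₂ : Homotopic g h) :
    Homotopic f h := by
  obtain ⟨H, hH, h0, h1, hx, hy⟩ := homotopic_iff.1 h₁
  obtain ⟨K, hK, k0, k1, kx, ky⟩ := homotopic_iff.1 h₂
  have c1 := continuous_firstHalf
  have c2 := continuous_secondHalf
  have hF := hH.comp (isContinuous_of_continuous
    (f := fun p : unitInterval × unitInterval => (p.1, firstHalf p.2)) (by fun_prop))
  have hG := hK.comp (isContinuous_of_continuous
    (f := fun p : unitInterval × unitInterval => (p.1, secondHalf p.2)) (by fun_prop))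
  refine homotopic_iff.2 ⟨_, IsContinuous.paste (k := fun p => (p.2 : ℝ)) (by fun_prop) (1 / 2)
    hF hG ?_, ?_, ?_, ?_, ?_⟩
  · rintro ⟨t, s⟩ hs
    simp only at hs
    simp [firstHalf_of_eq hs, secondHalf_of_le hs.le, h1, k0]
  · intro t
    simp [h0]
  · intro t
    norm_num [k1]
  · intro s
    simp [hx, kx]
  · intro s
    simp [hy, ky]

/-- Concatenation: `f (2 t)` for `t ≤ 1 / 2` and `g (2 t - 1)` for `t ≥ 1 / 2`. -/
noncomputable def trans (f : CPath c x y) (g : CPath c y z) : CPath c x z where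
  toFun t := if (t : ℝ) ≤ 1 / 2 then f.toFun (firstHalf t) else g.toFun (secondHalf t)
  continuous_toFun := IsContinuous.paste (by fun_prop) _
    (f.continuous_toFun.comp (isContinuous_of_continuous continuous_firstHalf))
    (g.continuous_toFun.comp (isContinuous_of_continuous continuous_secondHalf))
    (fun t ht => by
      simp [firstHalf_of_eq ht, secondHalf_of_le ht.le, f.target, g.source])
  source := by simp [f.source]
  target := by norm_num [g.target]

theorem trans_of_le (f : CPath c x y) (g : CPath c y z) {t : unitInterval}
    (h : (t : ℝ) ≤ 1 / 2) : (f.trans g).toFun t = f.toFun (firstHalf t) := if_pos h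

theorem trans_of_ge (f : CPath c x y) (g : CPath c y z) {t : unitInterval}
    (h : 1 / 2 ≤ (t : ℝ)) : (f.trans g).toFun t = g.toFun (secondHalf t) := by
  rcases h.lt_or_eq with h | h
  · exact if_neg h.not_ge
  · rw [trans_of_le _ _ h.symm.le, firstHalf_of_eq h.symm, secondHalf_of_le h.symm.le, f.target,
      g.source]

/-- The constant path. -/
def refl (c : CechClosure X) (x : X) : CPath c x x where
  toFun _ := x
  continuous_toFun := isContinuous_const _ _ x
  source := rfl
  target := rfl

/-- The inverse path `t ↦ f (1 - t)`. -/
def symm (f : CPath c x y) : CPath c y x where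
  toFun t := f.toFun (unitInterval.symm t)
  continuous_toFun := f.continuous_toFun.comp (isContinuous_of_continuous (by fun_prop))
  source := by simp [f.target]
  target := by simp [f.source]

theorem Homotopic.comp {f f' : CPath c x y} {g g' : CPath c y z} (h₁ : Homotopic f f')
    (h₂ : Homotopic g g') : Homotopic (f.trans g) (f'.trans g') := by
  obtain ⟨H, hH, h0, h1, hx, hy⟩ := homotopic_iff.1 h₁
  obtain ⟨K, hK, k0, k1, kx, ky⟩ := homotopic_iff.1 h₂
  have c1 := continuous_firstHalf
  have c2 := continuous_secondHalf
  have hF := hH.comp (isContinuous_of_continuous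
    (f := fun p : unitInterval × unitInterval => (firstHalf p.1, p.2)) (by fun_prop))
  have hG := hK.comp (isContinuous_of_continuous
    (f := fun p : unitInterval × unitInterval => (secondHalf p.1, p.2)) (by fun_prop))
  refine homotopic_iff.2 ⟨_, IsContinuous.paste (k := fun p => (p.1 : ℝ)) (by fun_prop) (1 / 2)
    hF hG ?_, ?_, ?_, ?_, ?_⟩
  · rintro ⟨t, s⟩ hs
    simp only at hs
    simp [firstHalf_of_eq hs, secondHalf_of_le hs.le, hy, kx]
  · intro t
    simp only [Function.comp_apply, h0, k0]
    rfl
  · intro t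
    simp only [Function.comp_apply, h1, k1]
    rfl
  · intro s
    simp [hx]
  · intro s
    norm_num [ky]

theorem Homotopic.inv {f g : CPath c x y} (h : Homotopic f g) : Homotopic f.symm g.symm := by
  obtain ⟨H, hH, h0, h1, hx, hy⟩ := homotopic_iff.1 h
  refine homotopic_iff.2 ⟨H ∘ fun p => (unitInterval.symm p.1, p.2),
    hH.comp (isContinuous_of_continuous (by fun_prop)), fun t => h0 _, fun t => h1 _, ?_, ?_⟩ <;>
    intro t <;> simp [hx, hy]

theorem refl_trans_homotopic (f : CPath c x y) : Homotopic ((refl c x).trans f) f := by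
  refine homotopic_of_reparam f.toFun f.continuous_toFun secondHalf id continuous_secondHalf
    continuous_id (secondHalf_of_le (by simp)) secondHalf_one _ _ (fun t => ?_) (fun _ => rfl)
  rcases le_total (t : ℝ) (1 / 2) with h | h
  · rw [trans_of_le _ _ h, secondHalf_of_le h, f.source]
    rfl
  · rw [trans_of_ge _ _ h]

theorem symm_trans_homotopic (f : CPath c x y) : Homotopic (f.symm.trans f) (refl c y) := by
  refine homotopic_of_reparam f.toFun f.continuous_toFun
    (fun t => projIcc 0 1 zero_le_one |2 * (t : ℝ) - 1|) (fun _ => 1)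
    (continuous_projIcc.comp (by fun_prop)) continuous_const ?_ ?_ _ _ (fun t => ?_)
    (fun _ => f.target.symm)
  · simp
  · norm_num
  · rcases le_total (t : ℝ) (1 / 2) with h | h
    · rw [trans_of_le _ _ h]
      change f.toFun _ = f.toFun _
      congr 1
      ext
      have := t.2.1
      rw [abs_of_nonpos (by linarith), projIcc_of_mem _ ⟨by linarith, by linarith⟩,
        unitInterval.coe_symm_eq, coe_firstHalf h]
      ring
    · rw [trans_of_ge _ _ h, abs_of_nonneg (by linarith)]
      rfl

theorem trans_assoc_homotopic {x' : X} (f : CPath c x y) (g : CPath c y z) (h : CPath c z x') :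
    Homotopic ((f.trans g).trans h) (f.trans (g.trans h)) := by
  let φ : unitInterval → unitInterval := fun t => projIcc 0 1 zero_le_one
    (min (2 * (t : ℝ)) (min ((t : ℝ) + 1 / 4) (((t : ℝ) + 1) / 2)))
  have hφ : Continuous φ := continuous_projIcc.comp (by fun_prop)
  refine homotopic_of_reparam (f.trans (g.trans h)).toFun (f.trans (g.trans h)).continuous_toFun
    φ id hφ continuous_id ?_ ?_ _ _ (fun t => ?_) (fun _ => rfl)
  · simp [φ]
  · norm_num [φ]
  · have ht0 := t.2.1
    have ht1 := t.2.2
    rcases le_total (t : ℝ) (1 / 2) with h1 | h1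
    · rw [trans_of_le _ _ h1]
      have e1 := coe_firstHalf h1
      rcases le_total (t : ℝ) (1 / 4) with h2 | h2
      · have hv : (φ t : ℝ) = 2 * t := by
          simp only [φ]
          rw [min_eq_left (le_min (by linarith) (by linarith)),
            projIcc_of_mem _ ⟨by linarith, by linarith⟩]
        rw [trans_of_le _ _ (by linarith), trans_of_le _ _ (by linarith)]
        congr 2
        ext
        rw [e1, hv]
      · have hv : (φ t : ℝ) = t + 1 / 4 := by
          simp only [φ]
          rw [min_eq_left (a := (t : ℝ) + 1 / 4) (by linarith), min_eq_right (by linarith),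
            projIcc_of_mem _ ⟨by linarith, by linarith⟩]
        have e2 := coe_secondHalf (t := φ t) (by linarith)
        rw [trans_of_ge _ _ (by linarith), trans_of_ge _ _ (by linarith),
          trans_of_le _ _ (by linarith)]
        congr 1
        ext
        rw [coe_secondHalf (t := firstHalf t) (by linarith),
          coe_firstHalf (t := secondHalf (φ t)) (by linarith), e1, e2, hv]
        ring
    · rw [trans_of_ge _ _ h1]
      have hv : (φ t : ℝ) = (t + 1) / 2 := by
        simp only [φ]
        rw [min_eq_right (a := (t : ℝ) + 1 / 4) (by linarith), min_eq_right (by linarith),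
          projIcc_of_mem _ ⟨by linarith, by linarith⟩]
      have e2 := coe_secondHalf (t := φ t) (by linarith)
      rw [trans_of_ge _ _ (by linarith), trans_of_ge _ _ (by linarith)]
      congr 1
      ext
      rw [coe_secondHalf h1, coe_secondHalf (by linarith), e2, hv]
      ring

/-- Homotopy with fixed endpoints as an equivalence relation. -/
def homotopySetoid (c : CechClosure X) (x y : X) : Setoid (CPath c x y) where
  r := Homotopic
  iseqv := ⟨Homotopic.refl, Homotopic.symm, Homotopic.trans⟩

end CPath

/-- The fundamental group of the pointed closure space `(X, c, x₀)`: homotopy classes of loops. -/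
def FundamentalGroup (c : CechClosure X) (x₀ : X) : Type u :=
  Quotient (CPath.homotopySetoid c x₀ x₀)

namespace FundamentalGroup

variable {c : CechClosure X} {x₀ : X}

/-- The homotopy class of a loop. -/
def mk (f : CPath c x₀ x₀) : FundamentalGroup c x₀ := Quotient.mk _ f

theorem sound {f g : CPath c x₀ x₀} (h : f.Homotopic g) : mk f = mk g := Quotient.sound h

noncomputable instance : Mul (FundamentalGroup c x₀) :=
  ⟨Quotient.map₂ CPath.trans fun _ _ h₁ _ _ h₂ => CPath.Homotopic.comp h₁ h₂⟩

instance : One (FundamentalGroup c x₀) := ⟨mk (CPath.refl c x₀)⟩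

instance : Inv (FundamentalGroup c x₀) :=
  ⟨Quotient.map CPath.symm fun _ _ h => CPath.Homotopic.inv h⟩

theorem mk_mul_mk (f g : CPath c x₀ x₀) : mk f * mk g = mk (f.trans g) := rfl

/-- The group structure induced by concatenation of loops. -/
noncomputable instance : Group (FundamentalGroup c x₀) :=
  Group.ofLeftAxioms
    (by
      rintro ⟨f⟩ ⟨g⟩ ⟨h⟩
      exact sound (CPath.trans_assoc_homotopic f g h))
    (by
      rintro ⟨f⟩
      exact sound (CPath.refl_trans_homotopic f))
    (by
      rintro ⟨f⟩
      exact sound (CPath.symm_trans_homotopic f))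

end FundamentalGroup

/-! ### Singular homology -/

/-- The standard `n`-simplex with the subspace topology, as a closure space. -/
abbrev simplexI (n : ℕ) : CechClosure (stdSimplex ℝ (Fin (n + 1))) :=
  ofTopology (stdSimplex ℝ (Fin (n + 1)))

/-- A singular `n`-simplex in the closure space `(X, c)`. -/
@[ext] structure SingularSimplex (c : CechClosure X) (n : ℕ) where
  toFun : stdSimplex ℝ (Fin (n + 1)) → X
  continuous_toFun : IsContinuous (simplexI n) c toFun

/-- The `i`-th face, the restriction to the face opposite to the `i`-th vertex. -/
noncomputable def SingularSimplex.face {c : CechClosure X} {n : ℕ}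
    (σ : SingularSimplex c (n + 1)) (i : Fin (n + 2)) : SingularSimplex c n where
  toFun := σ.toFun ∘ stdSimplex.map i.succAbove
  continuous_toFun := σ.continuous_toFun.comp
    (isContinuous_of_continuous (stdSimplex.continuous_map _))

/-- Singular `n`-chains: the free abelian group on the singular `n`-simplices. -/
abbrev SingularChain (c : CechClosure X) (n : ℕ) : Type u :=
  FreeAbelianGroup (SingularSimplex c n)

/-- The boundary map from `n`-chains to `(n - 1)`-chains; it is zero for `n = 0`. -/
noncomputable def boundary (c : CechClosure X) :
    (n : ℕ) → SingularChain c n →+ SingularChain c (n - 1)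
  | 0 => 0
  | n + 1 => FreeAbelianGroup.lift fun σ : SingularSimplex c (n + 1) =>
      ∑ i : Fin (n + 2), (-1 : ℤ) ^ (i : ℕ) • FreeAbelianGroup.of (σ.face i)

/-- The group of `n`-cycles. -/
noncomputable def cycles (c : CechClosure X) (n : ℕ) : AddSubgroup (SingularChain c n) :=
  (boundary c n).ker

/-- The group of `n`-boundaries. -/
noncomputable def boundaries (c : CechClosure X) (n : ℕ) : AddSubgroup (SingularChain c n) :=
  (boundary c (n + 1)).range

/-- The singular homology group `H_n`: cycles modulo boundaries. -/
abbrev SingularHomology (c : CechClosure X) (n : ℕ) : Type u :=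
  cycles c n ⧸ (boundaries c n).addSubgroupOf (cycles c n)

/-! ### The Hurewicz map in dimension one -/

theorem boundary_one {c : CechClosure X} (σ : SingularSimplex c 1) :
    boundary c 1 (FreeAbelianGroup.of σ) =
      FreeAbelianGroup.of (σ.face 0) - FreeAbelianGroup.of (σ.face 1) := by
  simp [boundary, Fin.sum_univ_two, sub_eq_add_neg]

theorem boundary_two {c : CechClosure X} (σ : SingularSimplex c 2) :
    boundary c 2 (FreeAbelianGroup.of σ) =
      FreeAbelianGroup.of (σ.face 0) - FreeAbelianGroup.of (σ.face 1)
        + FreeAbelianGroup.of (σ.face 2) := by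
  simp [boundary, Fin.sum_univ_three, sub_eq_add_neg]

theorem stdSimplex_map_apply {n m : ℕ} {f : Fin n → Fin m} (hf : Function.Injective f)
    (p : stdSimplex ℝ (Fin n)) (i : Fin n) : stdSimplex.map f p (f i) = p i := by
  rw [stdSimplex.map_coe, FunOnFinite.linearMap_apply_apply]
  simp [hf.eq_iff]
  rw [Finset.sum_filter]
  simp

theorem stdSimplex_map_apply_zero {n m : ℕ} {f : Fin n → Fin m}
    (p : stdSimplex ℝ (Fin n)) (j : Fin m) (hj : ∀ i, f i ≠ j) : stdSimplex.map f p j = 0 := by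
  rw [stdSimplex.map_coe, FunOnFinite.linearMap_apply_apply]
  simp [hj]

namespace CPath

variable {c : CechClosure X} {x y z x₀ : X}

/-- A path as a singular `1`-simplex, through the homeomorphism of the standard `1`-simplex with
the unit interval that sends the vertex `e₀` to `0` and `e₁` to `1`. -/
noncomputable def toSimplex (f : CPath c x y) : SingularSimplex c 1 where
  toFun := f.toFun ∘ stdSimplexHomeomorphUnitInterval
  continuous_toFun := f.continuous_toFun.comp
    (isContinuous_of_continuous stdSimplexHomeomorphUnitInterval.continuous)

theorem toSimplex_apply (f : CPath c x y) (p : stdSimplex ℝ (Fin 2)) :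
    f.toSimplex.toFun p = f.toFun (stdSimplexHomeomorphUnitInterval p) := rfl

theorem coe_homeo (p : stdSimplex ℝ (Fin 2)) :
    ((stdSimplexHomeomorphUnitInterval p : unitInterval) : ℝ) = p 1 := rfl

theorem face_apply {n : ℕ} (σ : SingularSimplex c (n + 1)) (i : Fin (n + 2))
    (p : stdSimplex ℝ (Fin (n + 1))) :
    (σ.face i).toFun p = σ.toFun (stdSimplex.map i.succAbove p) := rfl

theorem boundary_loop (f : CPath c x x) :
    FreeAbelianGroup.of f.toSimplex ∈ cycles c 1 := by
  change boundary c 1 _ = 0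
  rw [boundary_one, sub_eq_zero]
  congr 1
  ext p
  have h0 : stdSimplexHomeomorphUnitInterval (stdSimplex.map (Fin.succAbove 0) p) = 1 := by
    ext
    rw [coe_homeo, show (1 : Fin 2) = Fin.succAbove 0 0 from rfl,
      stdSimplex_map_apply Fin.succAbove_right_injective]
    simp
  have h1 : stdSimplexHomeomorphUnitInterval (stdSimplex.map (Fin.succAbove 1) p) = 0 := by
    ext
    rw [coe_homeo, stdSimplex_map_apply_zero _ _ (fun i => Fin.succAbove_ne _ _)]
    simp
  rw [face_apply, face_apply, toSimplex_apply, toSimplex_apply, h0, h1, f.source, f.target]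

/-- The homology class of a loop. -/
noncomputable def homologyClass (f : CPath c x₀ x₀) : SingularHomology c 1 :=
  QuotientAddGroup.mk ⟨FreeAbelianGroup.of f.toSimplex, f.boundary_loop⟩

/-- The coordinates of the three faces of the standard `2`-simplex. -/
theorem face_coords (p : stdSimplex ℝ (Fin 2)) :
    (stdSimplex.map (Fin.succAbove (0 : Fin 3)) p 1 = p 0 ∧
      stdSimplex.map (Fin.succAbove (0 : Fin 3)) p 2 = p 1) ∧
    (stdSimplex.map (Fin.succAbove (1 : Fin 3)) p 1 = 0 ∧
      stdSimplex.map (Fin.succAbove (1 : Fin 3)) p 2 = p 1) ∧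
    (stdSimplex.map (Fin.succAbove (2 : Fin 3)) p 1 = p 1 ∧
      stdSimplex.map (Fin.succAbove (2 : Fin 3)) p 2 = 0) := by
  refine ⟨⟨?_, ?_⟩, ⟨?_, ?_⟩, ⟨?_, ?_⟩⟩
  · exact stdSimplex_map_apply Fin.succAbove_right_injective p 0
  · exact stdSimplex_map_apply Fin.succAbove_right_injective p 1
  · exact stdSimplex_map_apply_zero p 1 (fun i => Fin.succAbove_ne _ _)
  · exact stdSimplex_map_apply Fin.succAbove_right_injective p 1
  · exact stdSimplex_map_apply Fin.succAbove_right_injective p 1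
  · exact stdSimplex_map_apply_zero p 2 (fun i => Fin.succAbove_ne _ _)

theorem continuous_coord {n : ℕ} (i : Fin n) :
    Continuous fun p : stdSimplex ℝ (Fin n) => p i :=
  (continuous_apply i).comp continuous_subtype_val

theorem homologyClass_eq_of_homotopic {f g : CPath c x₀ x₀} (h : Homotopic f g) :
    f.homologyClass = g.homologyClass := by
  obtain ⟨H, hH, h0, h1, hx, hy⟩ := homotopic_iff.1 h
  have c1 := continuous_coord (n := 3) 1
  have c2 := continuous_coord (n := 3) 2
  let u : stdSimplex ℝ (Fin 3) → unitInterval := fun p => projIcc 0 1 zero_le_one (p 2)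
  let v : stdSimplex ℝ (Fin 3) → unitInterval := fun p => projIcc 0 1 zero_le_one (p 1 + p 2)
  have hu : Continuous u := continuous_projIcc.comp c2
  have hv : Continuous v := continuous_projIcc.comp (c1.add c2)
  let σ : SingularSimplex c 2 :=
    ⟨H ∘ fun p => (u p, v p), hH.comp (isContinuous_of_continuous (by fun_prop))⟩
  let τ : SingularSimplex c 2 :=
    ⟨H ∘ fun p => (v p, u p), hH.comp (isContinuous_of_continuous (by fun_prop))⟩
  have pr : ∀ (t : unitInterval) (a : ℝ), a = t → projIcc 0 1 zero_le_one a = t := by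
    rintro t _ rfl
    exact projIcc_val _ _
  have key : ∀ (q : stdSimplex ℝ (Fin 3)) (s t : unitInterval), q 2 = s → q 1 + q 2 = t →
      σ.toFun q = H (s, t) ∧ τ.toFun q = H (t, s) := by
    intro q s t hs ht
    have e1 : u q = s := pr _ _ hs
    have e2 : v q = t := pr _ _ ht
    exact ⟨by simp [σ, e1, e2], by simp [τ, e1, e2]⟩
  have k0 : ∀ p : stdSimplex ℝ (Fin 2), (σ.face 0).toFun p = g.toSimplex.toFun p ∧
      (τ.face 0).toFun p = x₀ := by
    intro p
    obtain ⟨⟨a, b⟩, -, -⟩ := face_coords p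
    have := key (stdSimplex.map (Fin.succAbove (0 : Fin 3)) p)
      (stdSimplexHomeomorphUnitInterval p) 1 b (by rw [a, b]; exact stdSimplex.add_eq_one p)
    rw [face_apply, face_apply, this.1, this.2, h1, hy]
    exact ⟨rfl, rfl⟩
  have k1 : ∀ p : stdSimplex ℝ (Fin 2), (σ.face 1).toFun p = (τ.face 1).toFun p := by
    intro p
    obtain ⟨-, ⟨a, b⟩, -⟩ := face_coords p
    have := key (stdSimplex.map (Fin.succAbove (1 : Fin 3)) p)
      (stdSimplexHomeomorphUnitInterval p) (stdSimplexHomeomorphUnitInterval p) b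
      (by rw [a, b, zero_add]; rfl)
    rw [face_apply, face_apply, this.1, this.2]
  have k2 : ∀ p : stdSimplex ℝ (Fin 2), (σ.face 2).toFun p = x₀ ∧
      (τ.face 2).toFun p = f.toSimplex.toFun p := by
    intro p
    obtain ⟨-, -, ⟨a, b⟩⟩ := face_coords p
    have := key (stdSimplex.map (Fin.succAbove (2 : Fin 3)) p) 0
      (stdSimplexHomeomorphUnitInterval p) b (by rw [a, b, add_zero]; rfl)
    rw [face_apply, face_apply, this.1, this.2, h0, hx]
    exact ⟨rfl, rfl⟩
  have f0 : σ.face 0 = g.toSimplex := SingularSimplex.ext (funext fun p => (k0 p).1)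
  have f1 : σ.face 1 = τ.face 1 := SingularSimplex.ext (funext k1)
  have f2 : σ.face 2 = τ.face 0 :=
    SingularSimplex.ext (funext fun p => (k2 p).1.trans (k0 p).2.symm)
  have f3 : τ.face 2 = f.toSimplex := SingularSimplex.ext (funext fun p => (k2 p).2)
  refine (QuotientAddGroup.eq).2 ?_
  rw [AddSubgroup.mem_addSubgroupOf]
  refine ⟨FreeAbelianGroup.of σ - FreeAbelianGroup.of τ, ?_⟩
  rw [map_sub, boundary_two, boundary_two, f0, f1, f2, f3]
  simp only [AddSubgroup.coe_add, AddSubgroup.coe_neg]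
  abel

theorem homologyClass_trans (f g : CPath c x₀ x₀) :
    (f.trans g).homologyClass = f.homologyClass + g.homologyClass := by
  have c1 := continuous_coord (n := 3) 1
  have c2 := continuous_coord (n := 3) 2
  let u : stdSimplex ℝ (Fin 3) → unitInterval := fun p =>
    projIcc 0 1 zero_le_one (p 1 / 2 + p 2)
  have hu : Continuous u := continuous_projIcc.comp ((c1.div_const 2).add c2)
  let σ : SingularSimplex c 2 :=
    ⟨(f.trans g).toFun ∘ u, (f.trans g).continuous_toFun.comp (isContinuous_of_continuous hu)⟩
  have pr : ∀ a : ℝ, 0 ≤ a → a ≤ 1 → (projIcc 0 1 zero_le_one a : ℝ) = a := by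
    intro a h0 h1
    rw [projIcc_of_mem _ ⟨h0, h1⟩]
  have f0 : σ.face 0 = g.toSimplex := by
    ext p
    obtain ⟨⟨a, b⟩, -, -⟩ := face_coords p
    have hp := stdSimplex.add_eq_one p
    have hp0 := stdSimplex.zero_le p 0
    have hp1 := stdSimplex.zero_le p 1
    have e : (u (stdSimplex.map (Fin.succAbove (0 : Fin 3)) p) : ℝ) = p 0 / 2 + p 1 := by
      simp only [u, a, b]
      exact pr _ (by linarith) (by linarith)
    change (f.trans g).toFun (u (stdSimplex.map (Fin.succAbove (0 : Fin 3)) p)) =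
      g.toFun (stdSimplexHomeomorphUnitInterval p)
    rw [trans_of_ge _ _ (by linarith)]
    congr 1
    ext
    rw [coe_secondHalf (by linarith), e, coe_homeo]
    linarith
  have f1 : σ.face 1 = (f.trans g).toSimplex := by
    ext p
    obtain ⟨-, ⟨a, b⟩, -⟩ := face_coords p
    change (f.trans g).toFun (u (stdSimplex.map (Fin.succAbove (1 : Fin 3)) p)) =
      (f.trans g).toFun (stdSimplexHomeomorphUnitInterval p)
    congr 1
    ext
    simp only [u, a, b, coe_homeo, zero_div, zero_add]
    exact pr _ (stdSimplex.zero_le p 1) (stdSimplex.le_one p 1)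
  have f2 : σ.face 2 = f.toSimplex := by
    ext p
    obtain ⟨-, -, ⟨a, b⟩⟩ := face_coords p
    have hp0 := stdSimplex.zero_le p 1
    have hp1 := stdSimplex.le_one p 1
    have e : (u (stdSimplex.map (Fin.succAbove (2 : Fin 3)) p) : ℝ) = p 1 / 2 := by
      simp only [u, a, b, add_zero]
      exact pr _ (by linarith) (by linarith)
    change (f.trans g).toFun (u (stdSimplex.map (Fin.succAbove (2 : Fin 3)) p)) =
      f.toFun (stdSimplexHomeomorphUnitInterval p)
    rw [trans_of_le _ _ (by linarith)]
    congr 1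
    ext
    rw [coe_firstHalf (by linarith), e, coe_homeo]
    ring
  change (QuotientAddGroup.mk _ : SingularHomology c 1) = QuotientAddGroup.mk (_ + _)
  refine (QuotientAddGroup.eq).2 ?_
  rw [AddSubgroup.mem_addSubgroupOf]
  refine ⟨FreeAbelianGroup.of σ, ?_⟩
  rw [boundary_two, f0, f1, f2]
  simp only [AddSubgroup.coe_add, AddSubgroup.coe_neg]
  abel

end CPath

/-- The Hurewicz homomorphism in dimension one: the homotopy class of a loop is sent to the
homology class of that loop. The additive group `H_1` is written multiplicatively. -/
noncomputable def hurewicz (c : CechClosure X) (x₀ : X) :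
    FundamentalGroup c x₀ →* Multiplicative (SingularHomology c 1) :=
  MonoidHom.mk' (Quotient.lift (fun f => Multiplicative.ofAdd (CPath.homologyClass f))
      fun _ _ h => congrArg Multiplicative.ofAdd (CPath.homologyClass_eq_of_homotopic h))
    (by
      rintro ⟨f⟩ ⟨g⟩
      exact congrArg Multiplicative.ofAdd (CPath.homologyClass_trans f g))

theorem hurewicz_mk (c : CechClosure X) (x₀ : X) (f : CPath c x₀ x₀) :
    hurewicz c x₀ (FundamentalGroup.mk f) = Multiplicative.ofAdd f.homologyClass := rfl

end CechClosure

/-! Choose a path `γ x` from `x₀` to every point `x`. Closing up a singular 1-simplex by these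
paths, σ ↦ γ(σ e₀) · σ · γ(σ e₁)⁻¹, defines a homomorphism Φ from 1-chains to the abelianized
fundamental group (`chainToAbelianization`), and Φ inverts the Hurewicz map in two senses.

Kernel: Φ kills boundaries (`chainToAbelianization_boundary`), because a simplex is convex: the
paths e₀ → e₁ → e₂ and e₀ → e₂ are homotopic in it, and a singular 2-simplex carries that homotopy
to X. On a loop f, Φ is the class of f, since the conjugation by `γ x₀` disappears in an abelian
group. So a loop that bounds is trivial in the abelianization.

Surjectivity: modulo boundaries, concatenation of paths becomes addition and reversal becomes
negation (`chainClass_trans`, `chainClass_symm`), also for paths that are not loops. Hence h(Φ z) =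
z - K(∂z), where K sends a point x to the class of `γ x` (`lift_hurewicz_chainToAbelianization`); on
a cycle the correction vanishes.

The closure structure of X causes no trouble: the homotopies and 2-simplices constructed here live
on topological spaces and reach X by composition with a continuous map. -/

namespace CechClosure

variable {X : Type u} {Y : Type v}

/-! ### Images of paths and homotopies. -/

namespace CPath

variable {c : CechClosure X} {d : CechClosure Y} {x y z x₀ : X}

/-- The image of a path under a continuous map. -/
def map {p q : Y} (f : CPath d p q) {σ : Y → X} (hσ : IsContinuous d c σ) :
    CPath c (σ p) (σ q) where
  toFun := σ ∘ f.toFun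
  continuous_toFun := hσ.comp f.continuous_toFun
  source := congrArg σ f.source
  target := congrArg σ f.target

/-- Postcomposition leaves the parameter alone, so this is an equality and not only a homotopy. -/
theorem map_trans {p q r : Y} (f : CPath d p q) (g : CPath d q r) {σ : Y → X}
    (hσ : IsContinuous d c σ) : (f.trans g).map hσ = (f.map hσ).trans (g.map hσ) := by
  ext t
  exact apply_ite σ _ _ _

theorem Homotopic.map {p q : Y} {f g : CPath d p q} (h : Homotopic f g) {σ : Y → X}
    (hσ : IsContinuous d c σ) : Homotopic (f.map hσ) (g.map hσ) := by
  obtain ⟨H, hH, h0, h1, hx, hy⟩ := h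
  refine ⟨σ ∘ H, hσ.comp hH, fun t => congrArg σ (h0 t), fun t => congrArg σ (h1 t),
    fun s => congrArg σ (hx s), fun s => congrArg σ (hy s)⟩

end CPath

/-! ### Segments and convexity of the standard simplex. -/

/-- The point dividing the segment from `p` to `q` in the ratio `t : 1 - t`. -/
def segmentPoint {n : ℕ} (p q : stdSimplex ℝ (Fin n)) (t : unitInterval) :
    stdSimplex ℝ (Fin n) :=
  ⟨(1 - (t : ℝ)) • (p : Fin n → ℝ) + (t : ℝ) • (q : Fin n → ℝ),
    convex_stdSimplex ℝ (Fin n) p.2 q.2 (by linarith [t.2.2]) t.2.1 (by ring)⟩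

theorem segmentPoint_apply {n : ℕ} (p q : stdSimplex ℝ (Fin n)) (t : unitInterval) (i : Fin n) :
    segmentPoint p q t i = (1 - (t : ℝ)) * p i + t * q i := rfl

theorem continuous_segmentPoint {n : ℕ} : Continuous
    fun a : stdSimplex ℝ (Fin n) × stdSimplex ℝ (Fin n) × unitInterval =>
      segmentPoint a.1 a.2.1 a.2.2 := by
  unfold segmentPoint
  fun_prop

@[simp] theorem segmentPoint_zero {n : ℕ} (p q : stdSimplex ℝ (Fin n)) :
    segmentPoint p q 0 = p := by
  ext i
  simp [segmentPoint_apply]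

@[simp] theorem segmentPoint_one {n : ℕ} (p q : stdSimplex ℝ (Fin n)) :
    segmentPoint p q 1 = q := by
  ext i
  simp [segmentPoint_apply]

@[simp] theorem segmentPoint_self {n : ℕ} (p : stdSimplex ℝ (Fin n)) (t : unitInterval) :
    segmentPoint p p t = p := by
  ext i
  rw [segmentPoint_apply]
  ring

/-- `stdSimplex.map f` is the restriction of a linear map. This identifies segments of a face with
segments of the whole simplex. -/
theorem map_segmentPoint {n m : ℕ} (f : Fin n → Fin m) (p q : stdSimplex ℝ (Fin n))
    (t : unitInterval) :
    stdSimplex.map f (segmentPoint p q t) =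
      segmentPoint (stdSimplex.map f p) (stdSimplex.map f q) t := by
  apply Subtype.ext
  change FunOnFinite.linearMap ℝ ℝ f ((1 - (t : ℝ)) • (p : Fin n → ℝ) + (t : ℝ) • ⇑q) = _
  rw [map_add, map_smul, map_smul]
  rfl

/-- The straight path between two points of the standard simplex. -/
def segmentPath {n : ℕ} (p q : stdSimplex ℝ (Fin (n + 1))) : CPath (simplexI n) p q where
  toFun := segmentPoint p q
  continuous_toFun := isContinuous_of_continuous
    (continuous_segmentPoint.comp (f := fun t => (p, q, t)) (by fun_prop))
  source := segmentPoint_zero p q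
  target := segmentPoint_one p q

/-- The straight-line homotopy stays inside the simplex by convexity, and it fixes endpoints because
a segment from a point to itself is constant. -/
theorem homotopic_of_simplex {n : ℕ} {p q : stdSimplex ℝ (Fin (n + 1))}
    (f g : CPath (simplexI n) p q) : f.Homotopic g := by
  -- Between topological spaces, closure continuity is ordinary continuity; the neighborhood filters
  -- translate one into the other.
  have cont : ∀ h : CPath (simplexI n) p q, Continuous h.toFun := by
    intro h
    rw [continuous_iff_continuousAt]
    intro t
    have := isContinuous_iff.1 h.continuous_toFun t
    rwa [nhds_ofTopology, nhds_ofTopology] at this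
  have hf := cont f
  have hg := cont g
  refine CPath.homotopic_iff.2 ⟨fun a => segmentPoint (f.toFun a.1) (g.toFun a.1) a.2,
    isContinuous_of_continuous (continuous_segmentPoint.comp
      (f := fun a : unitInterval × unitInterval => (f.toFun a.1, g.toFun a.1, a.2))
      (by fun_prop)), ?_, ?_, ?_, ?_⟩
  · intro t
    simp
  · intro t
    simp
  · intro s
    simp [f.source, g.source]
  · intro s
    simp [f.target, g.target]

/-! ### Singular simplices along segments. -/

namespace SingularSimplex

variable {c : CechClosure X}

/-- The restriction of a singular simplex to a segment. -/
def segment {n : ℕ} (σ : SingularSimplex c n) (p q : stdSimplex ℝ (Fin (n + 1))) :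
    CPath c (σ.toFun p) (σ.toFun q) :=
  (segmentPath p q).map σ.continuous_toFun

/-- The homotopy exists already in the simplex and is pushed forward by σ. This is how a 2-simplex
yields a relation in the fundamental group. -/
theorem segment_trans_homotopic {n : ℕ} (σ : SingularSimplex c n)
    (p q r : stdSimplex ℝ (Fin (n + 1))) :
    ((σ.segment p q).trans (σ.segment q r)).Homotopic (σ.segment p r) := by
  unfold segment
  rw [← CPath.map_trans]
  exact (homotopic_of_simplex _ _).map σ.continuous_toFun

theorem segment_face {n : ℕ} (σ : SingularSimplex c (n + 1)) (i : Fin (n + 2))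
    (p q : stdSimplex ℝ (Fin (n + 1))) :
    ((σ.face i).segment p q).toFun =
      (σ.segment (stdSimplex.map i.succAbove p) (stdSimplex.map i.succAbove q)).toFun := by
  funext t
  exact congrArg σ.toFun (map_segmentPoint _ p q t)

/-- The path traversed by a singular `1`-simplex. -/
noncomputable def toPath (σ : SingularSimplex c 1) :
    CPath c (σ.toFun (stdSimplex.vertex 0)) (σ.toFun (stdSimplex.vertex 1)) :=
  σ.segment (stdSimplex.vertex 0) (stdSimplex.vertex 1)

/-- The homeomorphism reads off the coordinate `p 1`, which is the parameter of p on the segment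
from e₀ to e₁. -/
theorem segmentPoint_vertex (p : stdSimplex ℝ (Fin 2)) :
    segmentPoint (stdSimplex.vertex 0) (stdSimplex.vertex 1)
      (stdSimplexHomeomorphUnitInterval p) = p := by
  have h := stdSimplex.add_eq_one p
  ext i
  rw [segmentPoint_apply, CPath.coe_homeo]
  fin_cases i
  · simp
    linarith
  · simp

theorem toSimplex_toPath (σ : SingularSimplex c 1) : σ.toPath.toSimplex = σ := by
  ext p
  exact congrArg σ.toFun (segmentPoint_vertex p)

/-- Only the underlying functions are compared, since the endpoints on the left are values at
vertices and the path types differ in form. -/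
theorem toPath_toSimplex {x y : X} (f : CPath c x y) : f.toSimplex.toPath.toFun = f.toFun := by
  funext t
  obtain ⟨p, rfl⟩ := stdSimplexHomeomorphUnitInterval.surjective t
  exact congrFun (congrArg SingularSimplex.toFun (toSimplex_toPath f.toSimplex)) p

end SingularSimplex

/-! ### Chains modulo boundaries -/

/-- Singular `1`-chains modulo boundaries. -/
abbrev ChainClass (c : CechClosure X) : Type u := SingularChain c 1 ⧸ boundaries c 1

/-- The inclusion of homology into the chains modulo boundaries. -/
noncomputable def homologyToChainClass (c : CechClosure X) :
    SingularHomology c 1 →+ ChainClass c :=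
  QuotientAddGroup.map _ _ (cycles c 1).subtype le_rfl

/-- Both quotients divide by the same boundaries. Identities in homology may therefore be checked
among chains modulo boundaries, where paths that are not cycles also have classes. -/
theorem homologyToChainClass_injective (c : CechClosure X) :
    Function.Injective (homologyToChainClass c) := by
  rw [injective_iff_map_eq_zero]
  rintro ⟨z⟩ hz
  exact (QuotientAddGroup.eq_zero_iff z).2
    ((QuotientAddGroup.eq_zero_iff (z : SingularChain c 1)).1 hz)

theorem mk_boundary_two {c : CechClosure X} (σ : SingularSimplex c 2) :
    (QuotientAddGroup.mk (FreeAbelianGroup.of (σ.face 1)) : ChainClass c) =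
      QuotientAddGroup.mk (FreeAbelianGroup.of (σ.face 2)) +
        QuotientAddGroup.mk (FreeAbelianGroup.of (σ.face 0)) := by
  rw [← QuotientAddGroup.mk_add, QuotientAddGroup.eq]
  refine ⟨FreeAbelianGroup.of σ, ?_⟩
  rw [boundary_two]
  abel

/-! ### Paths as chains modulo boundaries. -/

namespace CPath

variable {c : CechClosure X} {x y z x₀ : X}

/-- The class of a path in the chains modulo boundaries. -/
noncomputable def chainClass (f : CPath c x y) : ChainClass c :=
  QuotientAddGroup.mk (FreeAbelianGroup.of f.toSimplex)

/-- The relation comes from a degenerate 2-simplex: the concatenation composed with an affine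
projection of the triangle to the interval. -/
theorem chainClass_trans (f : CPath c x y) (g : CPath c y z) :
    (f.trans g).chainClass = f.chainClass + g.chainClass := by
  have c1 := continuous_coord (n := 3) 1
  have c2 := continuous_coord (n := 3) 2
  -- The affine map with e₀, e₁, e₂ ↦ 0, 1/2, 1, so that the edges e₀e₁, e₁e₂, e₀e₂ carry f, g and
  -- their concatenation. The clamp never acts on the simplex.
  let u : stdSimplex ℝ (Fin 3) → unitInterval := fun p =>
    projIcc 0 1 zero_le_one (p 1 / 2 + p 2)
  have hu : Continuous u := continuous_projIcc.comp ((c1.div_const 2).add c2)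
  let σ : SingularSimplex c 2 :=
    ⟨(f.trans g).toFun ∘ u, (f.trans g).continuous_toFun.comp (isContinuous_of_continuous hu)⟩
  have pr : ∀ a : ℝ, 0 ≤ a → a ≤ 1 → (projIcc 0 1 zero_le_one a : ℝ) = a := by
    intro a h0 h1
    rw [projIcc_of_mem _ ⟨h0, h1⟩]
  have f0 : σ.face 0 = g.toSimplex := by
    ext p
    obtain ⟨⟨a, b⟩, -, -⟩ := face_coords p
    have hp := stdSimplex.add_eq_one p
    have hp0 := stdSimplex.zero_le p 0
    have hp1 := stdSimplex.zero_le p 1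
    have e : (u (stdSimplex.map (Fin.succAbove (0 : Fin 3)) p) : ℝ) = p 0 / 2 + p 1 := by
      simp only [u, a, b]
      exact pr _ (by linarith) (by linarith)
    change (f.trans g).toFun (u (stdSimplex.map (Fin.succAbove (0 : Fin 3)) p)) =
      g.toFun (stdSimplexHomeomorphUnitInterval p)
    rw [trans_of_ge _ _ (by linarith)]
    congr 1
    ext
    rw [coe_secondHalf (by linarith), e, coe_homeo]
    linarith
  have f1 : σ.face 1 = (f.trans g).toSimplex := by
    ext p
    obtain ⟨-, ⟨a, b⟩, -⟩ := face_coords p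
    change (f.trans g).toFun (u (stdSimplex.map (Fin.succAbove (1 : Fin 3)) p)) =
      (f.trans g).toFun (stdSimplexHomeomorphUnitInterval p)
    congr 1
    ext
    simp only [u, a, b, coe_homeo, zero_div, zero_add]
    exact pr _ (stdSimplex.zero_le p 1) (stdSimplex.le_one p 1)
  have f2 : σ.face 2 = f.toSimplex := by
    ext p
    obtain ⟨-, -, ⟨a, b⟩⟩ := face_coords p
    have hp0 := stdSimplex.zero_le p 1
    have hp1 := stdSimplex.le_one p 1
    have e : (u (stdSimplex.map (Fin.succAbove (2 : Fin 3)) p) : ℝ) = p 1 / 2 := by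
      simp only [u, a, b, add_zero]
      exact pr _ (by linarith) (by linarith)
    change (f.trans g).toFun (u (stdSimplex.map (Fin.succAbove (2 : Fin 3)) p)) =
      f.toFun (stdSimplexHomeomorphUnitInterval p)
    rw [trans_of_le _ _ (by linarith)]
    congr 1
    ext
    rw [coe_firstHalf (by linarith), e, coe_homeo]
    ring
  have h := mk_boundary_two σ
  rwa [f0, f1, f2] at h

/-- The constant path equals its own concatenation with itself, so its class satisfies a = a + a. -/
theorem chainClass_refl : (refl c x).chainClass = 0 := by
  have h := chainClass_trans (refl c x) (refl c x)
  have e : (refl c x).trans (refl c x) = refl c x := by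
    ext t
    exact ite_self x
  rw [e] at h
  exact left_eq_add.1 h

theorem chainClass_symm (f : CPath c x y) : f.symm.chainClass = -f.chainClass := by
  -- Here e₀ and e₂ go to 0 and e₁ to 1: the triangle runs along f and back, and the edge e₀e₂ is
  -- constant.
  let u : stdSimplex ℝ (Fin 3) → unitInterval := fun p => projIcc 0 1 zero_le_one (p 1)
  have hu : Continuous u := continuous_projIcc.comp (continuous_coord (n := 3) 1)
  let σ : SingularSimplex c 2 :=
    ⟨f.toFun ∘ u, f.continuous_toFun.comp (isContinuous_of_continuous hu)⟩
  have key : ∀ (q : stdSimplex ℝ (Fin 3)) (t : unitInterval), q 1 = t →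
      σ.toFun q = f.toFun t := by
    intro q t h
    change f.toFun (projIcc 0 1 zero_le_one (q 1)) = _
    rw [h, projIcc_val]
  have f0 : σ.face 0 = f.symm.toSimplex := by
    ext p
    refine key _ (unitInterval.symm (stdSimplexHomeomorphUnitInterval p)) ?_
    rw [(face_coords p).1.1, unitInterval.coe_symm_eq, coe_homeo]
    linarith [stdSimplex.add_eq_one p]
  have f1 : σ.face 1 = (refl c x).toSimplex := by
    ext p
    exact (key _ 0 (face_coords p).2.1.1).trans f.source
  have f2 : σ.face 2 = f.toSimplex := by
    ext p
    exact key _ _ (face_coords p).2.2.1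
  have h := mk_boundary_two σ
  rw [f0, f1, f2] at h
  exact eq_neg_of_add_eq_zero_right (h.symm.trans chainClass_refl)

/-! ### Closing up paths to loops at the base point. -/

/-- The loop at `x₀` obtained from a path by joining its endpoints to `x₀`. -/
noncomputable def toLoop (γ : ∀ x, CPath c x₀ x) (f : CPath c x y) : CPath c x₀ x₀ :=
  ((γ x).trans f).trans (γ y).symm

variable (γ : ∀ x, CPath c x₀ x)

theorem Homotopic.toLoop {f g : CPath c x y} (h : Homotopic f g) :
    Homotopic (f.toLoop γ) (g.toLoop γ) :=
  ((Homotopic.refl _).comp h).comp (Homotopic.refl _)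

theorem toLoop_trans (f : CPath c x y) (g : CPath c y z) :
    Homotopic ((f.toLoop γ).trans (g.toLoop γ)) ((f.trans g).toLoop γ) := by
  -- The return along `γ y` cancels against the next departure along it.
  have h : Homotopic ((γ y).symm.trans (((γ y).trans g).trans (γ z).symm))
      (g.trans (γ z).symm) :=
    (trans_assoc_homotopic _ _ _).symm.trans <| Homotopic.comp
      ((trans_assoc_homotopic _ _ _).symm.trans <|
        ((symm_trans_homotopic (γ y)).comp (Homotopic.refl g)).trans (refl_trans_homotopic g))
      (Homotopic.refl _)
  exact (trans_assoc_homotopic _ _ _).trans <| ((Homotopic.refl _).comp h).trans <|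
    (trans_assoc_homotopic _ _ _).symm.trans <|
      (trans_assoc_homotopic _ _ _).comp (Homotopic.refl _)

/-- Endpoints that agree only propositionally make the paths incomparable as terms; their loops
share one type. -/
theorem mk_toLoop_congr {x' y' : X} {f : CPath c x y} {g : CPath c x' y'}
    (h : f.toFun = g.toFun) :
    FundamentalGroup.mk (f.toLoop γ) = FundamentalGroup.mk (g.toLoop γ) := by
  obtain rfl : x = x' := by rw [← f.source, ← g.source, h]
  obtain rfl : y = y' := by rw [← f.target, ← g.target, h]
  rw [CPath.ext h]

/-- The correction depends only on the endpoints, which is why it will cancel on cycles. -/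
theorem chainClass_toLoop (f : CPath c x y) :
    (f.toLoop γ).chainClass = f.chainClass + ((γ x).chainClass - (γ y).chainClass) := by
  rw [toLoop, chainClass_trans, chainClass_trans, chainClass_symm]
  abel

/-- `γ x₀` is a loop but need not be constant; closing up is conjugation by its class. -/
theorem abelianization_mk_toLoop (f : CPath c x₀ x₀) :
    Abelianization.of (FundamentalGroup.mk (f.toLoop γ)) =
      Abelianization.of (FundamentalGroup.mk f) := by
  change Abelianization.of
    (FundamentalGroup.mk (γ x₀) * FundamentalGroup.mk f * (FundamentalGroup.mk (γ x₀))⁻¹) = _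
  rw [map_mul, map_mul, map_inv, mul_inv_cancel_comm]

end CPath

/-! ### The inverse of the Hurewicz map -/

variable {c : CechClosure X} {x₀ : X} (γ : ∀ x, CPath c x₀ x)

/-- The homomorphism from `1`-chains to the abelianized fundamental group that closes up each
singular `1`-simplex to a loop by means of the paths `γ`. -/
noncomputable def chainToAbelianization :
    SingularChain c 1 →+ Additive (Abelianization (FundamentalGroup c x₀)) :=
  FreeAbelianGroup.lift fun σ =>
    Additive.ofMul (Abelianization.of (FundamentalGroup.mk (σ.toPath.toLoop γ)))

theorem chainToAbelianization_of (σ : SingularSimplex c 1) :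
    chainToAbelianization γ (FreeAbelianGroup.of σ) =
      Additive.ofMul (Abelianization.of (FundamentalGroup.mk (σ.toPath.toLoop γ))) :=
  FreeAbelianGroup.lift_apply_of _ _

theorem chainToAbelianization_face (σ : SingularSimplex c 2) (i : Fin 3) :
    chainToAbelianization γ (FreeAbelianGroup.of (σ.face i)) =
      Additive.ofMul (Abelianization.of (FundamentalGroup.mk
        ((σ.segment (stdSimplex.vertex (i.succAbove 0))
          (stdSimplex.vertex (i.succAbove 1))).toLoop γ))) := by
  rw [chainToAbelianization_of, SingularSimplex.toPath]
  congr 2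
  apply CPath.mk_toLoop_congr
  rw [SingularSimplex.segment_face, stdSimplex.map_vertex, stdSimplex.map_vertex]

/-- On generators, faces 2, 0 and 1 are the edges e₀e₁, e₁e₂ and e₀e₂, and the product of the first
two closed-up loops is homotopic to the third. -/
theorem chainToAbelianization_boundary (z : SingularChain c 2) :
    chainToAbelianization γ (boundary c 2 z) = 0 := by
  suffices h : (chainToAbelianization γ).comp (boundary c 2) = 0 from DFunLike.congr_fun h z
  ext σ
  have h := CPath.toLoop_trans γ (σ.segment (stdSimplex.vertex 0) (stdSimplex.vertex 1))
    (σ.segment (stdSimplex.vertex 1) (stdSimplex.vertex 2))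
  have h2 := FundamentalGroup.sound (h.trans ((σ.segment_trans_homotopic _ _ _).toLoop γ))
  rw [← FundamentalGroup.mk_mul_mk] at h2
  have h3 := congrArg (fun g => Additive.ofMul (Abelianization.of g)) h2
  simp only [map_mul, ofMul_mul] at h3
  change chainToAbelianization γ (boundary c 2 (FreeAbelianGroup.of σ)) = 0
  rw [boundary_two, map_add, map_sub, chainToAbelianization_face, chainToAbelianization_face,
    chainToAbelianization_face, sub_add_eq_add_sub, sub_eq_zero, add_comm]
  exact h3

theorem chainToAbelianization_toSimplex (f : CPath c x₀ x₀) :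
    chainToAbelianization γ (FreeAbelianGroup.of f.toSimplex) =
      Additive.ofMul (Abelianization.of (FundamentalGroup.mk f)) := by
  rw [chainToAbelianization_of,
    CPath.mk_toLoop_congr γ (SingularSimplex.toPath_toSimplex f), CPath.abelianization_mk_toLoop]

/-- Extending the assignment of `γ x` to a point `x` linearly to `0`-chains. -/
noncomputable def zeroChainCone : SingularChain c 0 →+ ChainClass c :=
  FreeAbelianGroup.lift fun σ => (γ (σ.toFun (stdSimplex.vertex 0))).chainClass

theorem zeroChainCone_of (σ : SingularSimplex c 0) :
    zeroChainCone γ (FreeAbelianGroup.of σ) =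
      (γ (σ.toFun (stdSimplex.vertex 0))).chainClass :=
  FreeAbelianGroup.lift_apply_of _ _

theorem lift_hurewicz_chainToAbelianization (z : SingularChain c 1) :
    homologyToChainClass c (Abelianization.lift (hurewicz c x₀)
      (chainToAbelianization γ z).toMul).toAdd =
      QuotientAddGroup.mk z - zeroChainCone γ (boundary c 1 z) := by
  -- Both sides are additive in z, so single simplices suffice.
  suffices h : ((homologyToChainClass c).comp (MonoidHom.toAdditiveLeft
      (Abelianization.lift (hurewicz c x₀)))).comp (chainToAbelianization γ) =
      QuotientAddGroup.mk' (boundaries c 1) - (zeroChainCone γ).comp (boundary c 1) from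
    DFunLike.congr_fun h z
  ext σ
  change homologyToChainClass c (Abelianization.lift (hurewicz c x₀)
      (chainToAbelianization γ (FreeAbelianGroup.of σ)).toMul).toAdd =
      QuotientAddGroup.mk (FreeAbelianGroup.of σ) -
        zeroChainCone γ (boundary c 1 (FreeAbelianGroup.of σ))
  rw [chainToAbelianization_of, boundary_one, map_sub, zeroChainCone_of, zeroChainCone_of]
  -- On the class of a loop, the Hurewicz map followed by the inclusion is `chainClass` by
  -- definition.
  change (σ.toPath.toLoop γ).chainClass = _
  rw [CPath.chainClass_toLoop, CPath.face_apply, CPath.face_apply, stdSimplex.map_vertex,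
    stdSimplex.map_vertex, CPath.chainClass, SingularSimplex.toSimplex_toPath, ← neg_sub,
    ← sub_eq_add_neg]
  rfl

/-! ### Surjectivity and kernel. -/

theorem hurewicz_surjective (γ : ∀ x, CPath c x₀ x) : Function.Surjective (hurewicz c x₀) := by
  intro a
  obtain ⟨z, hz⟩ := QuotientAddGroup.mk_surjective a.toAdd
  obtain ⟨g, hg⟩ := QuotientGroup.mk_surjective (chainToAbelianization γ z).toMul
  refine ⟨g, Multiplicative.toAdd.injective (homologyToChainClass_injective c ?_)⟩
  have h := lift_hurewicz_chainToAbelianization γ z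
  -- z is a cycle, so the cone term vanishes and g is a preimage.
  rw [show boundary c 1 z = 0 from z.2, map_zero, sub_zero, ← hg] at h
  rw [← hz]
  exact h

theorem hurewicz_ker (γ : ∀ x, CPath c x₀ x) :
    (hurewicz c x₀).ker = commutator (FundamentalGroup c x₀) := by
  -- Commutators die because the target is abelian; the other inclusion is the substance.
  refine le_antisymm ?_ (Abelianization.commutator_subset_ker _)
  rintro ⟨f⟩ hf
  have h : f.homologyClass = 0 := hf
  -- A vanishing class means that f is the boundary of a 2-chain w, and the chain homomorphism kills
  -- boundaries.
  obtain ⟨w, hw⟩ := (QuotientAddGroup.eq_zero_iff _).1 h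
  have h2 := chainToAbelianization_boundary γ w
  rw [hw] at h2
  exact (QuotientGroup.eq_one_iff _).1 ((chainToAbelianization_toSimplex γ f).symm.trans h2)

end CechClosure

theorem mainTheorem1 {X : Type u} (c : CechClosure X) (hX : c.IsPathConnected) (x₀ : X) :
    Function.Surjective (CechClosure.hurewicz c x₀) ∧
      (CechClosure.hurewicz c x₀).ker = commutator (CechClosure.FundamentalGroup c x₀) ∧
      Function.Bijective (Abelianization.lift (CechClosure.hurewicz c x₀)) := by
  -- An arbitrary choice of paths; the conclusions do not mention it.
  have γ : ∀ x, CechClosure.CPath c x₀ x := fun x => (hX x₀ x).some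
  have hs := CechClosure.hurewicz_surjective γ
  have hk := CechClosure.hurewicz_ker γ
  refine ⟨hs, hk, ?_, fun a => ?_⟩
  · rw [injective_iff_map_eq_one]
    rintro ⟨g⟩ hg
    exact (QuotientGroup.eq_one_iff g).2 (hk ▸ hg)
  · obtain ⟨g, hg⟩ := hs a
    exact ⟨Abelianization.of g, hg⟩
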